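/- **Setting.** A finite labelled Markov decision process (MDP) $\mathcal M$ consists of a finite set of states $S$, for each state $s$ a nonempty finite set $A(s)$ of actions, transition distributions $P(\cdot\mid s,a)$ on $S$, an initial state $s_0$, a labelling $L:S\to 2^{AP}$ with $AP$ finite (and a reward function, which plays no role). A policy $\pi$ assigns to each finite history $\rho=s_0\cdots s_n$ a probability distribution $\pi(\cdot\mid\rho)$ on $A(s_n)$. It has *finite memory* if there are a finite set $Q$, $m_0\in Q$, an update map $u:Q\times S\to Q$ and distributions $\alpha(m,s)$ on $A(s)$ such that $\pi(\cdot\mid s_0\cdots s_n)=\alpha(m_{n+1},s_n)$, where $m_{i+1}=u(m_i,s_i)$. The Markov chain $\mathcal M_\pi$ induced by $\pi$ has the histories as states, initial state $s_0$, labels $L(\mathrm{last}(\rho))$ and transition probabilities $P_\pi(\rho s'\mid\rho)=\sum_a\pi(a\mid\rho)P(s'\mid\mathrm{last}(\rho),a)$. A CPCTL (state) formula is built by the grammar $\Phi::=a\mid\neg a\mid\Phi_1\wedge\Phi_2\mid\mathbb P_{\ge q}[\Phi_1\mathbf W(\Phi_1\wedge\Phi_2)]$ with $a\in AP$, $q\in[0,1]$,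 and is interpreted in the states of a Markov chain with the usual PCTL semantics; in particular $\mathbb P_{\ge q}[\Phi_1\mathbf W(\Phi_1\wedge\Phi_2)]$ holds in a state iff the set of paths $\xi$ from it such that either all $\xi[i]$ satisfy $\Phi_1$, or some $\xi[j]$ satisfies $\Phi_1\wedge\Phi_2$ and all $\xi[i]$, $i\le j$, satisfy $\Phi_1$, has probability at least $q$. Let $\boldsymbol p$ be the tuple of the thresholds $q$ occurring in $\Phi$, and for a tuple $\boldsymbol d$ of numbers in $[0,1]$ let $\mathtt T(\Phi,\boldsymbol d)$ be $\Phi$ with its thresholds replaced by $\boldsymbol d$. In $\mathtt T(\Phi,\boldsymbol p-\eta)$ the number $\eta$ is subtracted from every threshold, and results below $0$ are replaced by $0$ (which does not change the meaning of the formula). Write $\mathcal M_\pi\models\Phi$ if the initial state of $\mathcal M_\pi$ satisfies $\Phi$. The policy $\pi$ *strictly satisfies* $\Phi$, written $\mathcal M_\pi\models_S\Phi$, if $\mathcal M_\pi\models\mathtt T(\Phi,\boldsymbol q)$ for some tuple $\boldsymbol q$ of numbers in $[0,1]$ with $q_j>p_j$ for all $j$. Finally, $\mathbb P(\Phi\mid\mathcal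 M_\pi)$ is the probability of the set of paths of $\mathcal M_\pi$ from the initial state whose first state satisfies $\Phi$; thus it is $1$ if $\mathcal M_\pi\models\Phi$ and $0$ otherwise. **Theorem (Close finite-memory policy).** Let $\mathcal M$ be a finite MDP, let $\Phi$ be a CPCTL formula with probability thresholds $\boldsymbol p$, and let $\pi$ be a (history-dependent, randomized) policy such that $\mathcal M_\pi\models_S\Phi$. Then for every real $\eta\ge 0$ there is a finite-memory policy $\pi'$ such that $$\mathbb P(\Phi\mid\mathcal M_{\pi'})\ \ge\ \mathbb P(\mathtt T(\Phi,\boldsymbol p-\eta)\mid\mathcal M_\pi).$$ -/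

import Mathlib

open MeasureTheory ProbabilityTheory

universe u v w

/-! ### Markov chains and their path measure -/

/-- A labelled Markov chain with state space `S` and atomic propositions `AP`. -/
structure MarkovChain (S : Type u) (AP : Type w) where
  /-- transition probabilities -/
  step : S → PMF S
  /-- initial state -/
  init : S
  /-- labelling function -/
  label : S → Set AP

namespace MarkovChain

variable {S : Type u} {AP : Type w} [MeasurableSpace S] [DiscreteMeasurableSpace S]

/-- The transition function as a Markov kernel on the discrete state space. -/
noncomputable def stepKernel (M : MarkovChain S AP) : Kernel S S where
  toFun s := (M.step s).toMeasure
  measurable' := Measurable.of_discrete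

instance (M : MarkovChain S AP) : IsMarkovKernel M.stepKernel :=
  ⟨fun s => PMF.toMeasure.isProbabilityMeasure (M.step s)⟩

/-- The law of the state at time `n + 1` given the trajectory up to time `n`. -/
noncomputable def historyKernel (M : MarkovChain S AP) (n : ℕ) :
    Kernel ((i : Finset.Iic n) → (fun _ : ℕ => S) i) S :=
  M.stepKernel.comap (fun x => x ⟨n, Finset.mem_Iic.2 le_rfl⟩) (measurable_pi_apply _)

instance (M : MarkovChain S AP) (n : ℕ) : IsMarkovKernel (M.historyKernel n) := by
  unfold historyKernel; infer_instance

/-- The probability measure on infinite state sequences of the chain started in `s`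
(on the product of the discrete σ-algebras, which is generated by the cylinder sets). It is
carried by the infinite paths starting in `s`. -/
noncomputable def pathMeasure (M : MarkovChain S AP) (s : S) : Measure (ℕ → S) :=
  Kernel.traj (X := fun _ : ℕ => S) M.historyKernel 0 (fun _ => s)

end MarkovChain

/-! ### Temporal operators on state sequences -/

/-- `A U B`: some state satisfies `B`, and `A` holds up to and including that state. -/
def PathUntil {S : Type u} (A B : S → Prop) (ξ : ℕ → S) : Prop :=
  ∃ j, B (ξ j) ∧ ∀ i ≤ j, A (ξ i)

/-- `G A`: every state satisfies `A`. -/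
def PathGlobally {S : Type u} (A : S → Prop) (ξ : ℕ → S) : Prop :=
  ∀ j, A (ξ j)

/-- `A W B`: weak until. -/
def PathWeakUntil {S : Type u} (A B : S → Prop) (ξ : ℕ → S) : Prop :=
  PathUntil A B ξ ∨ PathGlobally A ξ

/-! ### Continuing PCTL -/

/-- State formulas of continuing PCTL. The only path formulas are `Φ₁ W (Φ₁ ∧ Φ₂)`;
`probW q Φ₁ Φ₂` is the state formula `P_{≥ q} [Φ₁ W (Φ₁ ∧ Φ₂)]`. -/
inductive CPCTL (AP : Type w) : Type w where
  /-- the literal `a` -/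
  | atom (a : AP) : CPCTL AP
  /-- the literal `¬ a` -/
  | negAtom (a : AP) : CPCTL AP
  /-- conjunction -/
  | and (Φ₁ Φ₂ : CPCTL AP) : CPCTL AP
  /-- `P_{≥ q} [Φ₁ W (Φ₁ ∧ Φ₂)]` -/
  | probW (q : unitInterval) (Φ₁ Φ₂ : CPCTL AP) : CPCTL AP

namespace CPCTL

variable {AP : Type w}

/-- The positions of the probabilistic operators of a formula. The two copies of `Φ₁` in
`Φ₁ W (Φ₁ ∧ Φ₂)` are one and the same subformula. -/
def Index : CPCTL AP → Type
  | atom _ => Empty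
  | negAtom _ => Empty
  | and Φ₁ Φ₂ => Index Φ₁ ⊕ Index Φ₂
  | probW _ Φ₁ Φ₂ => Option (Index Φ₁ ⊕ Index Φ₂)

/-- The tuple of probability thresholds of a formula. -/
def thresholds : (Φ : CPCTL AP) → Index Φ → unitInterval
  | atom _ => Empty.elim
  | negAtom _ => Empty.elim
  | and Φ₁ Φ₂ => Sum.elim (thresholds Φ₁) (thresholds Φ₂)
  | probW q Φ₁ Φ₂ => fun j => j.elim q (Sum.elim (thresholds Φ₁) (thresholds Φ₂))

/-- `T(Φ, d)`: the formula `Φ` with its thresholds replaced by the tuple `d`. -/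
def T : (Φ : CPCTL AP) → (Index Φ → unitInterval) → CPCTL AP
  | atom a, _ => atom a
  | negAtom a, _ => negAtom a
  | and Φ₁ Φ₂, d => and (T Φ₁ fun j => d (Sum.inl j)) (T Φ₂ fun j => d (Sum.inr j))
  | probW _ Φ₁ Φ₂, d =>
      probW (d none) (T Φ₁ fun j => d (some (Sum.inl j))) (T Φ₂ fun j => d (some (Sum.inr j)))

/-- The tuple `p - η`, where `p` is the tuple of thresholds of `Φ`, truncated to `[0, 1]`
(a lower bound `≤ 0` on a probability says the same as the lower bound `0`). -/
noncomputable def loweredThresholds (Φ : CPCTL AP) (η : ℝ) : Index Φ → unitInterval :=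
  fun j => Set.projIcc 0 1 zero_le_one ((thresholds Φ j : ℝ) - η)

/-- Satisfaction `(M, s) ⊨ Φ`. -/
def Sat {S : Type u} [MeasurableSpace S] [DiscreteMeasurableSpace S] (M : MarkovChain S AP) :
    CPCTL AP → S → Prop
  | atom a, s => a ∈ M.label s
  | negAtom a, s => a ∉ M.label s
  | and Φ₁ Φ₂, s => Sat M Φ₁ s ∧ Sat M Φ₂ s
  | probW q Φ₁ Φ₂, s =>
      (q : ℝ) ≤ (M.pathMeasure s).real
        {ξ | PathWeakUntil (Sat M Φ₁) (fun t => Sat M Φ₁ t ∧ Sat M Φ₂ t) ξ}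

/-- `P(Φ | M)` for a state formula: the probability of the paths from the initial state of `M`
that satisfy `Φ`, i.e. whose first state satisfies `Φ`. -/
noncomputable def probability {S : Type u} [MeasurableSpace S] [DiscreteMeasurableSpace S]
    (M : MarkovChain S AP) (Φ : CPCTL AP) : ℝ :=
  (M.pathMeasure M.init).real {ξ | Sat M Φ (ξ 0)}

end CPCTL

/-! ### Markov decision processes and policies -/

/-- A labelled Markov decision process with states `S`, actions `A s` available in the state `s`
and atomic propositions `AP`. -/
structure MDP (S : Type u) (A : S → Type v) (AP : Type w) where
  /-- transition probabilities -/
  P : (s : S) → A s → PMF S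
  /-- initial state -/
  init : S
  /-- labelling function -/
  label : S → Set AP
  /-- reward function -/
  reward : S → ℝ

/-- Finite histories: nonempty words `s₀ s₁ ⋯ sₙ` of states. -/
inductive History (S : Type u) : Type u where
  /-- the history `s₀` -/
  | start (s : S) : History S
  /-- the history `s₀ ⋯ sₙ s` -/
  | snoc (ρ : History S) (s : S) : History S

namespace History

/-- The last state of a history. -/
def last {S : Type u} : History S → S
  | start s => s
  | snoc _ s => s

instance (S : Type u) : MeasurableSpace (History S) := ⊤

instance (S : Type u) : DiscreteMeasurableSpace (History S) := ⟨fun _ => trivial⟩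

end History

/-- A history-dependent randomized policy: a distribution over the available actions for every
history. (The values on words that are not paths of the process play no role: the induced chain
started in the initial state visits those words with probability zero.) -/
def Policy {S : Type u} (A : S → Type v) : Type (max u v) :=
  (ρ : History S) → PMF (A ρ.last)

/-- The state of a deterministic memory with initial state `m₀` and update function `upd` after
reading a history. -/
def History.memory {S : Type u} {Mem : Type*} (m₀ : Mem) (upd : Mem → S → Mem) : History S → Mem
  | start s => upd m₀ s
  | snoc ρ s => upd (ρ.memory m₀ upd) s

/-- A policy has finite memory if it is implemented by a finite-state memory: the distribution
over actions depends only on the current memory state and the current state. -/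
def Policy.FiniteMemory {S : Type u} {A : S → Type v} (π : Policy A) : Prop :=
  ∃ (k : ℕ) (m₀ : Fin k) (upd : Fin k → S → Fin k) (act : Fin k → (s : S) → PMF (A s)),
    ∀ ρ : History S, π ρ = act (ρ.memory m₀ upd) ρ.last

namespace MDP

variable {S : Type u} {A : S → Type v} {AP : Type w}

/-- The Markov chain induced by a policy: its states are the histories, and from `ρ` it moves to
`ρ s'` with probability `∑ a, π(a | ρ) P(s' | last ρ, a)`. -/
noncomputable def induced (M : MDP S A AP) (π : Policy A) : MarkovChain (History S) AP where
  step ρ := ((π ρ).bind fun a => M.P ρ.last a).map (History.snoc ρ)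
  init := History.start M.init
  label ρ := M.label ρ.last

/-- `M_π ⊨ Φ`: the induced chain satisfies `Φ` in its initial state. -/
def Satisfies (M : MDP S A AP) (π : Policy A) (Φ : CPCTL AP) : Prop :=
  CPCTL.Sat (M.induced π) Φ (M.induced π).init

/-- `M_π ⊨_S Φ`: the policy still satisfies `Φ` after some strict increase of all thresholds. -/
def StrictlySatisfies (M : MDP S A AP) (π : Policy A) (Φ : CPCTL AP) : Prop :=
  ∃ q : Φ.Index → unitInterval, (∀ j, Φ.thresholds j < q j) ∧ M.Satisfies π (Φ.T q)

end MDP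

/-! It suffices to find a finite-memory `π'` that satisfies `Φ` itself: the left-hand probability is
then `1`. Strictness provides a slack `δ > 0` common to all thresholds, and the construction may
spend it.

Attach to every history of `π` a point: its last state, the formulas it satisfies with slack, and
the true weak-until probabilities. Read as mere claims, points make sense without a history: a set
of them is self-sustaining if its claims are locally correct and every point has an action
distribution and successors in the set that support its bounds. Weak until is a greatest fixed
point, so local support already gives the claimed probability (`le_value`, `bound_le_value`). All
conditions are closed and the space of points is compact, hence the largest self-sustaining set is
compact (`isCompact_sustainable`). Fixing a choice at each of its points gives a policy with points
as memory.

To make the memory finite, jump after every `N` steps to a finite net, losing at most `ε = δ/2` in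
each relevant probability. These losses must not add up over infinitely many jumps. The net is
therefore exact near the top: a value at least `1 - c` jumps to value `1`, and value `1` is never
lost again (`value_blocks_eq_one`). If `N` is large, then from a net point it is unlikely that after
`N` steps the outcome is still open with value below `1 - c`, by a Markov inequality. So the total
loss is at most `2ε = δ` (`value_sub_le_value_blocks`). By induction on formulas every claim is then
true in the new chain (`sat_of_claims`). -/

/-! ### Weak until as a greatest fixed point. -/

/-- A finitely branching probabilistic system: from `x` the letter `s` is read with probability
`weight x s`, and then the state is `succ x s`. -/
structure BranchingSystem (S : Type*) [Fintype S] (X : Type*) where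
  /-- probability of the letter -/
  weight : X → S → ℝ
  /-- the successor state -/
  succ : X → S → X
  weight_nonneg : ∀ x s, 0 ≤ weight x s
  sum_weight : ∀ x, ∑ s, weight x s = 1

namespace BranchingSystem

variable {S X : Type*} [Fintype S] (𝒮 : BranchingSystem S X) (A B : X → Prop)

open Classical in
/-- The expansion operator of `A W (A ∧ B)`. -/
noncomputable def expand (f : X → ℝ) (x : X) : ℝ :=
  if A x then if B x then 1 else ∑ s, 𝒮.weight x s * f (𝒮.succ x s) else 0

/-- The probability that `A W (A ∧ B)` is not violated during the first `n` steps. -/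
noncomputable def approx (n : ℕ) : X → ℝ := (𝒮.expand A B)^[n] 1

/-- The probability of `A W (A ∧ B)`. -/
noncomputable def value (x : X) : ℝ := ⨅ n, 𝒮.approx A B n x

variable {A B}

theorem expand_mono {f g : X → ℝ} (h : f ≤ g) : 𝒮.expand A B f ≤ 𝒮.expand A B g := by
  intro x
  unfold expand
  split_ifs
  · exact le_rfl
  · exact Finset.sum_le_sum fun s _ => mul_le_mul_of_nonneg_left (h _) (𝒮.weight_nonneg x s)
  · exact le_rfl

theorem expand_le_one {f : X → ℝ} (h : f ≤ 1) : 𝒮.expand A B f ≤ 1 := by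
  intro x
  unfold expand
  split_ifs
  · exact le_rfl
  · calc _ ≤ ∑ s, 𝒮.weight x s * 1 :=
        Finset.sum_le_sum fun s _ => mul_le_mul_of_nonneg_left (h _) (𝒮.weight_nonneg x s)
      _ = 1 := by simp [𝒮.sum_weight]
  · exact zero_le_one

theorem expand_nonneg {f : X → ℝ} (h : 0 ≤ f) : 0 ≤ 𝒮.expand A B f := by
  intro x
  unfold expand
  split_ifs
  · exact zero_le_one
  · exact Finset.sum_nonneg fun s _ => mul_nonneg (𝒮.weight_nonneg x s) (h _)
  · exact le_rfl

theorem approx_zero : 𝒮.approx A B 0 = 1 := rfl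

theorem approx_succ (n : ℕ) : 𝒮.approx A B (n + 1) = 𝒮.expand A B (𝒮.approx A B n) :=
  Function.iterate_succ_apply' _ _ _

theorem approx_nonneg (n : ℕ) : 0 ≤ 𝒮.approx A B n := by
  induction n with
  | zero => exact fun _ => zero_le_one
  | succ n ih => rw [approx_succ]; exact 𝒮.expand_nonneg ih

theorem approx_le_one (n : ℕ) : 𝒮.approx A B n ≤ 1 := by
  induction n with
  | zero => exact le_rfl
  | succ n ih => rw [approx_succ]; exact 𝒮.expand_le_one ih

theorem antitone_approx : Antitone (𝒮.approx A B) := by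
  refine antitone_nat_of_succ_le fun n => ?_
  induction n with
  | zero => exact 𝒮.approx_le_one 1
  | succ n ih =>
    have h := 𝒮.expand_mono (A := A) (B := B) ih
    rwa [← approx_succ, ← approx_succ] at h

theorem bddBelow_approx (x : X) : BddBelow (Set.range fun n => 𝒮.approx A B n x) :=
  ⟨0, by rintro _ ⟨n, rfl⟩; exact 𝒮.approx_nonneg n x⟩

theorem value_le_approx (n : ℕ) : 𝒮.value A B ≤ 𝒮.approx A B n :=
  fun x => ciInf_le (𝒮.bddBelow_approx x) n

theorem value_nonneg : 0 ≤ 𝒮.value A B :=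
  fun x => le_ciInf fun n => 𝒮.approx_nonneg n x

theorem value_le_one : 𝒮.value A B ≤ 1 := 𝒮.value_le_approx 0

theorem tendsto_approx (x : X) :
    Filter.Tendsto (fun n => 𝒮.approx A B n x) Filter.atTop (nhds (𝒮.value A B x)) :=
  tendsto_atTop_ciInf (fun _ _ h => 𝒮.antitone_approx h x) (𝒮.bddBelow_approx x)

theorem expand_value : 𝒮.expand A B (𝒮.value A B) = 𝒮.value A B := by
  funext x
  refine tendsto_nhds_unique ?_ ((𝒮.tendsto_approx x).comp (Filter.tendsto_add_atTop_nat 1))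
  simp only [Function.comp_def, approx_succ]
  unfold expand
  split_ifs
  · exact tendsto_const_nhds
  · exact tendsto_finsetSum _ fun s _ => (𝒮.tendsto_approx _).const_mul _
  · exact tendsto_const_nhds

/-- The value is the limit of iterating a monotone operator downwards from `1`, so it dominates
every post-fixed point below `1`. Lower bounds on values of other systems are all obtained this way;
it would fail for strong until. -/
theorem le_value {f : X → ℝ} (h1 : f ≤ 1) (h : f ≤ 𝒮.expand A B f) : f ≤ 𝒮.value A B := by
  have key : ∀ n, f ≤ 𝒮.approx A B n := by
    intro n
    induction n with
    | zero => exact h1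
    | succ n ih => rw [approx_succ]; exact h.trans (𝒮.expand_mono ih)
  exact fun x => le_ciInf fun n => key n x

theorem iterate_mono {f g : X → ℝ} (h : f ≤ g) (n : ℕ) :
    (𝒮.expand A B)^[n] f ≤ (𝒮.expand A B)^[n] g :=
  Monotone.iterate (fun _ _ h => 𝒮.expand_mono h) n h

/-- The coefficients add up to `1`, so the constant branches `1` and `0` are respected. The sign of
`1 - c` is irrelevant, which matters when the lemma is applied with a large coefficient. -/
theorem expand_affine (f g : X → ℝ) (c : ℝ) :
    𝒮.expand A B (fun x => (1 - c) * f x + c * g x) =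
      fun x => (1 - c) * 𝒮.expand A B f x + c * 𝒮.expand A B g x := by
  funext x
  unfold expand
  split_ifs
  · ring
  · simp only [Finset.mul_sum, ← Finset.sum_add_distrib]
    exact Finset.sum_congr rfl fun s _ => by ring
  · ring

theorem iterate_affine (f g : X → ℝ) (c : ℝ) (n : ℕ) :
    (𝒮.expand A B)^[n] (fun x => (1 - c) * f x + c * g x) =
      fun x => (1 - c) * (𝒮.expand A B)^[n] f x + c * (𝒮.expand A B)^[n] g x := by
  induction n with
  | zero => rfl
  | succ n ih => simp only [Function.iterate_succ_apply', ih, expand_affine]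

theorem iterate_value (n : ℕ) : (𝒮.expand A B)^[n] (𝒮.value A B) = 𝒮.value A B :=
  Function.iterate_fixed 𝒮.expand_value n

/-- A constant loss passes unchanged through an average and disappears where the outcome is decided.
-/
theorem sub_le_iterate_sub {c : ℝ} (hc : 0 ≤ c) (n : ℕ) :
    (fun x => 𝒮.value A B x - c) ≤ (𝒮.expand A B)^[n] fun x => 𝒮.value A B x - c := by
  induction n with
  | zero => exact le_rfl
  | succ n ih =>
    rw [Function.iterate_succ_apply']
    refine le_trans ?_ (𝒮.expand_mono ih)
    intro x
    have h := (congrFun (𝒮.expand_value (A := A) (B := B)) x).symm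
    simp only
    rw [h]
    unfold expand
    split_ifs
    · linarith
    · simp only [mul_sub, Finset.sum_sub_distrib, ← Finset.sum_mul, 𝒮.sum_weight, one_mul]
      exact le_rfl
    · linarith

end BranchingSystem

/-! ### Weak until under the path measure. -/

/-- This is the safety form: a violation is visible at a finite time. If `B` ever occurs, its first
occurrence is the witness. -/
theorem pathWeakUntil_iff {S : Type*} (A B : S → Prop) (ξ : ℕ → S) :
    PathWeakUntil A (fun t => A t ∧ B t) ξ ↔ ∀ n, A (ξ n) ∨ ∃ j < n, B (ξ j) := by
  constructor
  · rintro (⟨j, ⟨-, hB⟩, hA⟩ | h) n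
    · rcases le_or_gt n j with h | h
      · exact Or.inl (hA n h)
      · exact Or.inr ⟨j, h, hB⟩
    · exact Or.inl (h n)
  · intro h
    by_cases hB : ∃ j, B (ξ j)
    · classical
      have hmin : ∀ i ≤ Nat.find hB, A (ξ i) := fun i hi =>
        (h i).resolve_right fun ⟨j, hj, hBj⟩ => Nat.find_min hB (hj.trans_le hi) hBj
      exact Or.inl ⟨Nat.find hB, ⟨hmin _ le_rfl, Nat.find_spec hB⟩, hmin⟩
    · push Not at hB
      exact Or.inr fun n => (h n).resolve_right fun ⟨j, _, hBj⟩ => hB j hBj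

/-- `A W (A ∧ B)` is not violated by the `m` states of `ξ` from time `n` on. -/
def WeakUntilUpTo {S : Type*} (A B : S → Prop) (m n : ℕ) (ξ : ℕ → S) : Prop :=
  ∀ k < m, A (ξ (n + k)) ∨ ∃ j < k, B (ξ (n + j))

theorem weakUntilUpTo_succ {S : Type*} (A B : S → Prop) (m n : ℕ) (ξ : ℕ → S) :
    WeakUntilUpTo A B (m + 1) n ξ ↔
      A (ξ n) ∧ (B (ξ n) ∨ WeakUntilUpTo A B m (n + 1) ξ) := by
  constructor
  · intro h
    refine ⟨by simpa using h 0 (by omega), ?_⟩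
    by_cases hB : B (ξ n)
    · exact Or.inl hB
    · refine Or.inr fun k hk => ?_
      rcases h (k + 1) (by omega) with h | ⟨j, hj, h⟩
      · exact Or.inl (by rwa [show n + 1 + k = n + (k + 1) by ring])
      · rcases j with - | j
        · exact absurd h hB
        · exact Or.inr ⟨j, by omega, by rwa [show n + 1 + j = n + (j + 1) by ring]⟩
  · rintro ⟨hA, h⟩ k hk
    rcases k with - | k
    · exact Or.inl hA
    · rcases h with h | h
      · exact Or.inr ⟨0, by omega, h⟩
      · rcases h k (by omega) with h | ⟨j, hj, h⟩
        · exact Or.inl (by rwa [show n + (k + 1) = n + 1 + k by ring])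
        · exact Or.inr ⟨j + 1, by omega, by rwa [show n + (j + 1) = n + 1 + j by ring]⟩

namespace MarkovChain

variable {S : Type u} {AP : Type w} [MeasurableSpace S] [DiscreteMeasurableSpace S]

instance (M : MarkovChain S AP) (s : S) : IsProbabilityMeasure (M.pathMeasure s) := by
  unfold pathMeasure; infer_instance

theorem measurableSet_weakUntilUpTo (A B : S → Prop) (m n : ℕ) :
    MeasurableSet {ξ : ℕ → S | WeakUntilUpTo A B m n ξ} := by
  have h : ∀ (C : S → Prop) (k : ℕ), Measurable fun ξ : ℕ → S => C (ξ k) := fun C k =>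
    (Measurable.of_discrete (f := C)).comp (measurable_pi_apply k)
  unfold WeakUntilUpTo
  refine measurableSet_setOfPred.2 (Measurable.forall fun k => measurable_const.imp ?_)
  exact (h A _).or (Measurable.exists fun j => measurable_const.and (h B _))

/-- The law of the next state given the past. -/
theorem lintegral_pathMeasure_succ (M : MarkovChain S AP) (s : S) (n : ℕ)
    (F : ((i : Finset.Iic n) → S) → S → ENNReal) (hF : Measurable (Function.uncurry F)) :
    ∫⁻ ξ, F (fun i => ξ i) (ξ (n + 1)) ∂M.pathMeasure s =
      ∫⁻ ξ, ∫⁻ y, F (fun i => ξ i) y ∂(M.step (ξ n)).toMeasure ∂M.pathMeasure s := by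
  have h := Kernel.partialTraj_compProd_eq_map_traj (X := fun _ : ℕ => S) (κ := M.historyKernel)
    (Nat.zero_le n) (x₀ := fun _ => s)
  have h1 := congrArg (fun μ => ∫⁻ z, Function.uncurry F z ∂μ) h
  rw [lintegral_map hF (by fun_prop), Measure.lintegral_compProd hF,
    ← Kernel.traj_map_frestrictLe_apply, lintegral_map] at h1
  · exact h1.symm
  · exact hF.lintegral_kernel_prod_right
  · fun_prop

theorem pathMeasure_start (M : MarkovChain S AP) (s : S) : ∀ᵐ ξ ∂M.pathMeasure s, ξ 0 = s := by
  have h := Kernel.traj_map_frestrictLe_apply (X := fun _ : ℕ => S) (κ := M.historyKernel) 0 0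
    (fun _ => s)
  rw [Kernel.partialTraj_self, Kernel.id_apply] at h
  have h1 : ∀ᵐ x ∂(Measure.dirac (fun _ => s) : Measure ((i : Finset.Iic 0) → S)),
      x ⟨0, by simp⟩ = s := by
    rw [ae_dirac_iff]
    have hm : Measurable fun x : (i : Finset.Iic 0) → S => x ⟨0, by simp⟩ := measurable_pi_apply _
    exact hm (MeasurableSet.of_discrete (s := {t | t = s}))
  rw [← h] at h1
  exact ae_of_ae_map (by fun_prop) h1

/-- The `m`-step probabilities of `A W (A ∧ B)`, by backward induction. -/
noncomputable def weakUntilApprox (M : MarkovChain S AP) (A B : S → Prop) : ℕ → S → ENNReal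
  | 0, _ => 1
  | m + 1, s => Set.indicator {s | A s ∧ B s} 1 s + Set.indicator {s | A s ∧ ¬ B s}
      (fun s => ∫⁻ t, weakUntilApprox M A B m t ∂(M.step s).toMeasure) s

/-- The event `C` about the past makes the induction on `m` go through: the part of `C` that is
still undecided at time `n` becomes the past event for time `n + 1`. -/
theorem lintegral_weakUntilApprox (M : MarkovChain S AP) (A B : S → Prop) (s : S) (m n : ℕ)
    (C : Set ((i : Finset.Iic n) → S)) (hC : MeasurableSet C) :
    ∫⁻ ξ, Set.indicator {ξ | (fun i : Finset.Iic n => ξ i) ∈ C}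
        (fun ξ => M.weakUntilApprox A B m (ξ n)) ξ ∂M.pathMeasure s =
      M.pathMeasure s {ξ | (fun i : Finset.Iic n => ξ i) ∈ C ∧ WeakUntilUpTo A B m n ξ} := by
  induction m generalizing n C with
  | zero =>
    have : {ξ : ℕ → S | (fun i : Finset.Iic n => ξ i) ∈ C ∧ WeakUntilUpTo A B 0 n ξ} =
        {ξ | (fun i : Finset.Iic n => ξ i) ∈ C} := by ext ξ; simp [WeakUntilUpTo]
    rw [this]
    simp only [weakUntilApprox]
    exact lintegral_indicator_one (hC.preimage (by fun_prop))
  | succ m ih =>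
    let last : Finset.Iic n := ⟨n, Finset.mem_Iic.2 le_rfl⟩
    have hcoord : ∀ D : Set S, MeasurableSet {x : (i : Finset.Iic n) → S | x last ∈ D} :=
      fun D => measurable_pi_apply last MeasurableSet.of_discrete
    let C₁ : Set ((i : Finset.Iic n) → S) := C ∩ {x | x last ∈ {t | A t ∧ B t}}
    let C₂ : Set ((i : Finset.Iic n) → S) := C ∩ {x | x last ∈ {t | A t ∧ ¬ B t}}
    have hC₁ : MeasurableSet C₁ := hC.inter (hcoord _)
    have hC₂ : MeasurableSet C₂ := hC.inter (hcoord _)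
    have hres : Measurable fun (ξ : ℕ → S) (i : Finset.Iic n) => ξ i := by fun_prop
    let F : ((i : Finset.Iic n) → S) → S → ENNReal := fun x y =>
      Set.indicator C₂ (fun _ => M.weakUntilApprox A B m y) x
    have hF : Measurable (Function.uncurry F) := by
      have : Function.uncurry F = Set.indicator (Prod.fst ⁻¹' C₂)
          (fun z => M.weakUntilApprox A B m z.2) := by
        ext ⟨x, y⟩
        rfl
      rw [this]
      exact ((Measurable.of_discrete (f := M.weakUntilApprox A B m)).comp measurable_snd).indicator
        (hC₂.preimage measurable_fst)
    have hsplit : ∀ ξ : ℕ → S, Set.indicator {ξ : ℕ → S | (fun i : Finset.Iic n => ξ i) ∈ C}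
        (fun ξ => M.weakUntilApprox A B (m + 1) (ξ n)) ξ =
        Set.indicator {ξ : ℕ → S | (fun i : Finset.Iic n => ξ i) ∈ C₁} 1 ξ +
          ∫⁻ y, F (fun i => ξ i) y ∂(M.step (ξ n)).toMeasure := by
      intro ξ
      by_cases h : (fun i : Finset.Iic n => ξ i) ∈ C <;> by_cases hA : A (ξ n) <;>
        by_cases hB : B (ξ n) <;> simp [F, C₁, C₂, last, weakUntilApprox, h, hA, hB]
    let C₃ : Set ((i : Finset.Iic (n + 1)) → S) :=
      {x | (fun i : Finset.Iic n => x ⟨i, Finset.mem_Iic.2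
        ((Finset.mem_Iic.1 i.2).trans (Nat.le_succ n))⟩) ∈ C₂}
    have hC₃ : MeasurableSet C₃ := hC₂.preimage (by fun_prop)
    have hnext : ∀ ξ : ℕ → S, F (fun i => ξ i) (ξ (n + 1)) =
        Set.indicator {ξ : ℕ → S | (fun i : Finset.Iic (n + 1) => ξ i) ∈ C₃}
          (fun ξ => M.weakUntilApprox A B m (ξ (n + 1))) ξ := fun ξ => rfl
    have hset : MeasurableSet {ξ : ℕ → S | (fun i : Finset.Iic n => ξ i) ∈ C₁} :=
      hC₁.preimage hres
    have hset₃ : MeasurableSet {ξ : ℕ → S | (fun i : Finset.Iic (n + 1) => ξ i) ∈ C₃} :=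
      hC₃.preimage (f := fun (ξ : ℕ → S) (i : Finset.Iic (n + 1)) => ξ i) (by fun_prop)
    have hind : Measurable (Set.indicator
        {ξ : ℕ → S | (fun i : Finset.Iic n => ξ i) ∈ C₁} (1 : (ℕ → S) → ENNReal)) :=
      measurable_one.indicator hset
    rw [lintegral_congr hsplit, lintegral_add_left hind,
      ← lintegral_pathMeasure_succ M s n F hF, lintegral_congr hnext, ih (n + 1) C₃ hC₃,
      lintegral_indicator_one hset, ← measure_union]
    · congr 1
      ext ξ
      simp only [Set.mem_union, Set.mem_ofPred_eq, C₃, C₁, C₂, last, Set.mem_inter_iff,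
        weakUntilUpTo_succ]
      tauto
    · rw [Set.disjoint_left]
      rintro ξ ⟨-, h⟩ ⟨⟨-, h'⟩, -⟩
      exact h'.2 h.2
    · exact hset₃.inter (measurableSet_weakUntilUpTo A B m (n + 1))

theorem pathMeasure_weakUntilUpTo (M : MarkovChain S AP) (A B : S → Prop) (s : S) (m : ℕ) :
    M.pathMeasure s {ξ | WeakUntilUpTo A B m 0 ξ} = M.weakUntilApprox A B m s := by
  have h := M.lintegral_weakUntilApprox A B s m 0 Set.univ MeasurableSet.univ
  simp only [Set.mem_univ, Set.ofPred_true, true_and, Set.indicator_univ] at h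
  rw [← h, lintegral_congr_ae (g := fun _ => M.weakUntilApprox A B m s)]
  · simp
  · filter_upwards [M.pathMeasure_start s] with ξ hξ
    rw [hξ]

/-- Continuity from above, as weak until is the decreasing intersection of its step-bounded
versions. -/
theorem tendsto_weakUntilApprox (M : MarkovChain S AP) (A B : S → Prop) (s : S) :
    Filter.Tendsto (fun m => (M.weakUntilApprox A B m s).toReal) Filter.atTop
      (nhds ((M.pathMeasure s).real {ξ | PathWeakUntil A (fun t => A t ∧ B t) ξ})) := by
  have hset : {ξ | PathWeakUntil A (fun t => A t ∧ B t) ξ} =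
      ⋂ m, {ξ : ℕ → S | WeakUntilUpTo A B m 0 ξ} := by
    ext ξ
    simp only [Set.mem_ofPred_eq, pathWeakUntil_iff, Set.mem_iInter, WeakUntilUpTo, zero_add]
    exact ⟨fun h m k _ => h k, fun h n => h (n + 1) n (Nat.lt_succ_self n)⟩
  have h := tendsto_measure_iInter_atTop (μ := M.pathMeasure s)
    (s := fun m => {ξ : ℕ → S | WeakUntilUpTo A B m 0 ξ})
    (fun m => (measurableSet_weakUntilUpTo A B m 0).nullMeasurableSet)
    (fun _ _ h _ hξ k hk => hξ k (hk.trans_le h)) ⟨0, measure_ne_top _ _⟩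
  rw [← hset] at h
  simp only [Function.comp_def, pathMeasure_weakUntilUpTo] at h
  exact (ENNReal.tendsto_toReal (measure_ne_top _ _)).comp h

end MarkovChain

/-! ### Induced chains as branching systems. -/

theorem PMF.sum_toReal {α : Type*} [Fintype α] (p : PMF α) : ∑ a, (p a).toReal = 1 := by
  rw [← ENNReal.toReal_sum fun a _ => p.apply_ne_top a, ← tsum_fintype (L := .unconditional α),
    p.tsum_coe, ENNReal.toReal_one]

theorem PMF.toReal_bind_apply {α β : Type*} [Fintype α] (p : PMF α) (f : α → PMF β) (b : β) :
    (p.bind f b).toReal = ∑ a, (p a).toReal * (f a b).toReal := by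
  rw [PMF.bind_apply, tsum_fintype, ENNReal.toReal_sum fun a _ =>
    ENNReal.mul_ne_top (p.apply_ne_top a) ((f a).apply_ne_top b)]
  simp only [ENNReal.toReal_mul]

theorem PMF.lintegral_toMeasure_map {α β : Type*} [Fintype α] [MeasurableSpace β]
    [DiscreteMeasurableSpace β] (p : PMF α) (f : α → β) (g : β → ENNReal) :
    ∫⁻ b, g b ∂(p.map f).toMeasure = ∑ a, p a * g (f a) := by
  let _ : MeasurableSpace α := ⊤
  have : DiscreteMeasurableSpace α := ⟨fun _ => trivial⟩
  rw [← PMF.toMeasure_map p (f := f) Measurable.of_discrete,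
    lintegral_map Measurable.of_discrete Measurable.of_discrete, lintegral_fintype]
  refine Finset.sum_congr rfl fun a _ => ?_
  rw [PMF.toMeasure_apply_singleton p a (MeasurableSet.singleton a), mul_comm]

namespace MDP

variable {S : Type u} {A : S → Type v} {AP : Type w} [Fintype S]

/-- The system of histories under a policy. -/
noncomputable def historySystem (M : MDP S A AP) (π : Policy A) :
    BranchingSystem S (History S) where
  weight ρ s := (((π ρ).bind (M.P ρ.last)) s).toReal
  succ := History.snoc
  weight_nonneg _ _ := ENNReal.toReal_nonneg
  sum_weight _ := PMF.sum_toReal _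

theorem weakUntilApprox_induced (M : MDP S A AP) (π : Policy A) (C D : History S → Prop)
    (n : ℕ) (ρ : History S) :
    (M.induced π).weakUntilApprox C D n ρ =
      ENNReal.ofReal ((M.historySystem π).approx C D n ρ) := by
  induction n generalizing ρ with
  | zero => simp [MarkovChain.weakUntilApprox, BranchingSystem.approx_zero]
  | succ n ih =>
    have key : ∫⁻ t, (M.induced π).weakUntilApprox C D n t ∂((M.induced π).step ρ).toMeasure =
        ENNReal.ofReal (∑ s, (M.historySystem π).weight ρ s *
          (M.historySystem π).approx C D n ((M.historySystem π).succ ρ s)) := by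
      have hstep : (M.induced π).step ρ = ((π ρ).bind (M.P ρ.last)).map (History.snoc ρ) := rfl
      rw [hstep, PMF.lintegral_toMeasure_map, ENNReal.ofReal_sum_of_nonneg]
      · refine Finset.sum_congr rfl fun s _ => ?_
        rw [ih, ENNReal.ofReal_mul ((M.historySystem π).weight_nonneg ρ s)]
        congr 1
        exact (ENNReal.ofReal_toReal (PMF.apply_ne_top _ _)).symm
      · exact fun s _ => mul_nonneg ((M.historySystem π).weight_nonneg ρ s)
          ((M.historySystem π).approx_nonneg n _)
    rw [BranchingSystem.approx_succ, MarkovChain.weakUntilApprox, BranchingSystem.expand]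
    by_cases hC : C ρ <;> by_cases hD : D ρ <;> simp [hC, hD, key]

/-- The probability of `C W (C ∧ D)` in the induced chain. -/
theorem pathMeasure_induced_weakUntil (M : MDP S A AP) (π : Policy A) (C D : History S → Prop)
    (ρ : History S) :
    ((M.induced π).pathMeasure ρ).real {ξ | PathWeakUntil C (fun t => C t ∧ D t) ξ} =
      (M.historySystem π).value C D ρ := by
  refine tendsto_nhds_unique ((M.induced π).tendsto_weakUntilApprox C D ρ) ?_
  simp only [weakUntilApprox_induced,
    ENNReal.toReal_ofReal ((M.historySystem π).approx_nonneg _ ρ)]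
  exact (M.historySystem π).tendsto_approx ρ

end MDP

/-! ### A uniform slack for all thresholds. -/

namespace CPCTL

variable {AP : Type w}

/-- Satisfaction with all thresholds raised by `δ`. -/
def SatRaised {S : Type u} [MeasurableSpace S] [DiscreteMeasurableSpace S]
    (M : MarkovChain S AP) (δ : ℝ) : CPCTL AP → S → Prop
  | atom a, s => a ∈ M.label s
  | negAtom a, s => a ∉ M.label s
  | and Φ₁ Φ₂, s => SatRaised M δ Φ₁ s ∧ SatRaised M δ Φ₂ s
  | probW q Φ₁ Φ₂, s =>
      (q : ℝ) + δ ≤ (M.pathMeasure s).real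
        {ξ | PathWeakUntil (SatRaised M δ Φ₁) (fun t => SatRaised M δ Φ₁ t ∧ SatRaised M δ Φ₂ t) ξ}

theorem exists_pos_forall_add_le (Φ : CPCTL AP) (q : Φ.Index → unitInterval)
    (h : ∀ j, Φ.thresholds j < q j) :
    ∃ δ : ℝ, 0 < δ ∧ ∀ j, (Φ.thresholds j : ℝ) + δ ≤ q j := by
  induction Φ with
  | atom a => exact ⟨1, one_pos, fun j => j.elim⟩
  | negAtom a => exact ⟨1, one_pos, fun j => j.elim⟩
  | and Φ₁ Φ₂ ih₁ ih₂ =>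
    obtain ⟨δ₁, h₁, hq₁⟩ := ih₁ (fun j => q (Sum.inl j)) fun j => h (Sum.inl j)
    obtain ⟨δ₂, h₂, hq₂⟩ := ih₂ (fun j => q (Sum.inr j)) fun j => h (Sum.inr j)
    refine ⟨min δ₁ δ₂, lt_min h₁ h₂, ?_⟩
    rintro (j | j)
    · exact (add_le_add_right (min_le_left _ _) _).trans (hq₁ j)
    · exact (add_le_add_right (min_le_right _ _) _).trans (hq₂ j)
  | probW p Φ₁ Φ₂ ih₁ ih₂ =>
    obtain ⟨δ₁, h₁, hq₁⟩ := ih₁ (fun j => q (some (Sum.inl j))) fun j => h (some (Sum.inl j))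
    obtain ⟨δ₂, h₂, hq₂⟩ := ih₂ (fun j => q (some (Sum.inr j))) fun j => h (some (Sum.inr j))
    have h₀ : (p : ℝ) < q none := h none
    refine ⟨min (q none - p) (min δ₁ δ₂), lt_min (sub_pos.2 h₀) (lt_min h₁ h₂), ?_⟩
    rintro (_ | j | j)
    · have := min_le_left ((q none : ℝ) - p) (min δ₁ δ₂)
      change (p : ℝ) + _ ≤ q none
      linarith
    · exact (add_le_add_right ((min_le_right _ _).trans (min_le_left _ _)) _).trans (hq₁ j)
    · exact (add_le_add_right ((min_le_right _ _).trans (min_le_right _ _)) _).trans (hq₂ j)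

theorem PathWeakUntil.mono {S : Type*} {A A' B B' : S → Prop} (hA : ∀ s, A s → A' s)
    (hB : ∀ s, B s → B' s) {ξ : ℕ → S} (h : PathWeakUntil A B ξ) : PathWeakUntil A' B' ξ :=
  h.imp (fun ⟨j, hj, hi⟩ => ⟨j, hB _ hj, fun i hij => hA _ (hi i hij)⟩) fun h j => hA _ (h j)

theorem satRaised_of_sat_T {S : Type u} [MeasurableSpace S] [DiscreteMeasurableSpace S]
    (M : MarkovChain S AP) {δ : ℝ} (Φ : CPCTL AP) (q : Φ.Index → unitInterval)
    (h : ∀ j, (Φ.thresholds j : ℝ) + δ ≤ q j) (s : S) (hs : Sat M (Φ.T q) s) :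
    SatRaised M δ Φ s := by
  induction Φ generalizing s with
  | atom a => exact hs
  | negAtom a => exact hs
  | and Φ₁ Φ₂ ih₁ ih₂ =>
    exact ⟨ih₁ _ (fun j => h (Sum.inl j)) s hs.1, ih₂ _ (fun j => h (Sum.inr j)) s hs.2⟩
  | probW p Φ₁ Φ₂ ih₁ ih₂ =>
    have h₁ := ih₁ _ (fun j => h (some (Sum.inl j)))
    have h₂ := ih₂ _ (fun j => h (some (Sum.inr j)))
    refine le_trans (le_trans (h none) hs) (measureReal_mono fun ξ hξ => ?_)
    exact PathWeakUntil.mono h₁ (fun t ht => ⟨h₁ t ht.1, h₂ t ht.2⟩) hξ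

theorem probability_le_one {S : Type u} [MeasurableSpace S] [DiscreteMeasurableSpace S]
    (M : MarkovChain S AP) (Φ : CPCTL AP) : probability M Φ ≤ 1 := measureReal_le_one

theorem probability_eq_one {S : Type u} [MeasurableSpace S] [DiscreteMeasurableSpace S]
    (M : MarkovChain S AP) (Φ : CPCTL AP) (h : Sat M Φ M.init) : probability M Φ = 1 := by
  have : ∀ᵐ ξ ∂M.pathMeasure M.init, ξ ∈ {ξ : ℕ → S | Sat M Φ (ξ 0)} := by
    filter_upwards [M.pathMeasure_start M.init] with ξ hξ
    rwa [hξ]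
  have h1 : M.pathMeasure M.init {ξ : ℕ → S | Sat M Φ (ξ 0)} = 1 := by
    rw [← measure_univ (μ := M.pathMeasure M.init)]
    exact measure_congr (Filter.eventuallyEq_univ.2 this)
  rw [probability, measureReal_def, h1, ENNReal.toReal_one]

end CPCTL

/-! ### Self-sustaining claims and their compactness. -/

/-- A state together with the formulas it is claimed to satisfy and, for each pair `(Φ₁, Φ₂)`, a
claimed lower bound on the probability of `Φ₁ W (Φ₁ ∧ Φ₂)`. -/
abbrev Point (S : Type u) (AP : Type w) : Type (max u w) :=
  S × (CPCTL AP → Bool) × (CPCTL AP × CPCTL AP → unitInterval)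

namespace Point

variable {S : Type u} {A : S → Type v} {AP : Type w}

/-- The claimed formulas are correct relative to the claimed probabilities, with slack `δ`. -/
def Correct (M : MDP S A AP) (δ : ℝ) (x : Point S AP) : Prop :=
  (∀ a, x.2.1 (.atom a) = true → a ∈ M.label x.1) ∧
  (∀ a, x.2.1 (.negAtom a) = true → a ∉ M.label x.1) ∧
  (∀ Φ₁ Φ₂, x.2.1 (.and Φ₁ Φ₂) = true → x.2.1 Φ₁ = true ∧ x.2.1 Φ₂ = true) ∧
  ∀ q Φ₁ Φ₂, x.2.1 (.probW q Φ₁ Φ₂) = true → (q : ℝ) + δ ≤ x.2.2 (Φ₁, Φ₂)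

/-- The claimed probabilities are consistent with those of the successors `y s`, reached with
probability `p s`. -/
def Consistent [Fintype S] (x : Point S AP) (p : S → ℝ) (y : S → Point S AP) : Prop :=
  ∀ Φ : CPCTL AP × CPCTL AP, (x.2.1 Φ.1 = false → (x.2.2 Φ : ℝ) = 0) ∧
    (x.2.1 Φ.1 = true → x.2.1 Φ.2 = false → (x.2.2 Φ : ℝ) ≤ ∑ s, p s * (y s).2.2 Φ)

/-- The distribution of the next state. -/
noncomputable def next (M : MDP S A AP) (x : Point S AP) (α : ∀ s, PMF (A s)) (s : S) : ℝ :=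
  ((α x.1).bind (M.P x.1) s).toReal

/-- From every point of `G` some choice of actions leads to points of `G` that substantiate the
claims. -/
def SelfSustaining [Fintype S] (M : MDP S A AP) (δ : ℝ) (G : Set (Point S AP)) : Prop :=
  ∀ x ∈ G, Correct M δ x ∧ ∃ (α : ∀ s, PMF (A s)) (y : S → Point S AP),
    (∀ s, y s ∈ G ∧ (y s).1 = s) ∧ Consistent x (next M x α) y

/-- The largest self-sustaining set. -/
def sustainable [Fintype S] (M : MDP S A AP) (δ : ℝ) : Set (Point S AP) :=
  {x | ∃ G, SelfSustaining M δ G ∧ x ∈ G}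

theorem SelfSustaining.subset_sustainable [Fintype S] {M : MDP S A AP} {δ : ℝ}
    {G : Set (Point S AP)} (h : SelfSustaining M δ G) : G ⊆ sustainable M δ :=
  fun _ hx => ⟨G, h, hx⟩

theorem selfSustaining_sustainable [Fintype S] (M : MDP S A AP) (δ : ℝ) :
    SelfSustaining M δ (sustainable M δ) := by
  rintro x ⟨G, hG, hx⟩
  obtain ⟨h, α, y, hy, hc⟩ := hG x hx
  exact ⟨h, α, y, fun s => ⟨⟨G, hG, (hy s).1⟩, (hy s).2⟩, hc⟩

/-- The distribution on a finite type with given point masses. -/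
noncomputable def _root_.PMF.ofUnitInterval {α : Type*} [Fintype α] (f : α → unitInterval)
    (h : ∑ a, (f a : ℝ) = 1) : PMF α :=
  PMF.ofFintype (fun a => ENNReal.ofReal (f a)) (by
    rw [← ENNReal.ofReal_sum_of_nonneg fun a _ => (f a).2.1, h, ENNReal.ofReal_one])

theorem _root_.PMF.toReal_ofUnitInterval {α : Type*} [Fintype α] (f : α → unitInterval)
    (h : ∑ a, (f a : ℝ) = 1) (a : α) : (PMF.ofUnitInterval f h a).toReal = f a := by
  rw [PMF.ofUnitInterval, PMF.ofFintype_apply, ENNReal.toReal_ofReal (f a).2.1]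

theorem _root_.isClosed_forall {ι Z : Type*} [TopologicalSpace Z] {P : ι → Z → Prop}
    (h : ∀ i, IsClosed {z | P i z}) : IsClosed {z | ∀ i, P i z} := by
  rw [Set.ofPred_forall]
  exact isClosed_iInter h

theorem _root_.isClosed_imp_of_discrete {D Z : Type*} [TopologicalSpace D] [DiscreteTopology D]
    [TopologicalSpace Z] {f : Z → D} (hf : Continuous f) (p : D → Prop) {P : Z → Prop}
    (hP : IsClosed {z | P z}) : IsClosed {z | p (f z) → P z} :=
  isClosed_imp ((isOpen_discrete {d | p d}).preimage hf) hP

theorem _root_.isClosed_of_discrete {D Z : Type*} [TopologicalSpace D] [DiscreteTopology D]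
    [TopologicalSpace Z] {f : Z → D} (hf : Continuous f) (p : D → Prop) : IsClosed {z | p (f z)} :=
  (isClosed_discrete {d | p d}).preimage hf

theorem continuous_claim [TopologicalSpace S] (Φ : CPCTL AP) :
    Continuous fun x : Point S AP => x.2.1 Φ := by fun_prop

theorem continuous_bound [TopologicalSpace S] (Φ : CPCTL AP × CPCTL AP) :
    Continuous fun x : Point S AP => (x.2.2 Φ : ℝ) := by fun_prop

theorem isClosed_consistent [TopologicalSpace S] [Fintype S] {Z : Type*} [TopologicalSpace Z] {f : Z → Point S AP}
    (hf : Continuous f) {p : S → Z → ℝ} (hp : ∀ s, Continuous (p s)) {y : S → Z → Point S AP}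
    (hy : ∀ s, Continuous (y s)) :
    IsClosed {z | Consistent (f z) (fun s => p s z) fun s => y s z} := by
  refine isClosed_forall fun Φ => IsClosed.and ?_ ?_
  · exact isClosed_imp_of_discrete ((continuous_claim _).comp hf) (· = false)
      (isClosed_eq ((continuous_bound _).comp hf) continuous_const)
  · refine isClosed_imp_of_discrete ((continuous_claim _).comp hf) (· = true)
      (isClosed_imp_of_discrete ((continuous_claim _).comp hf) (· = false)
      (isClosed_le ((continuous_bound _).comp hf) ?_))
    exact continuous_finsetSum _ fun s _ => (hp s).mul ((continuous_bound _).comp (hy s))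

section Topology

variable [TopologicalSpace S] [DiscreteTopology S]

theorem isClosed_correct (M : MDP S A AP) (δ : ℝ) : IsClosed {x | Correct M δ x} := by
  unfold Correct
  refine IsClosed.and ?_ (IsClosed.and ?_ (IsClosed.and ?_ ?_))
  · exact isClosed_forall fun a => isClosed_imp_of_discrete (continuous_claim _) (· = true)
      (isClosed_of_discrete continuous_fst fun s => a ∈ M.label s)
  · exact isClosed_forall fun a => isClosed_imp_of_discrete (continuous_claim _) (· = true)
      (isClosed_of_discrete continuous_fst fun s => a ∉ M.label s)
  · exact isClosed_forall fun Φ₁ => isClosed_forall fun Φ₂ =>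
      isClosed_imp_of_discrete (continuous_claim _) (· = true)
        ((isClosed_of_discrete (continuous_claim Φ₁) (· = true)).and
          (isClosed_of_discrete (continuous_claim Φ₂) (· = true)))
  · exact isClosed_forall fun q => isClosed_forall fun Φ₁ => isClosed_forall fun Φ₂ =>
      isClosed_imp_of_discrete (continuous_claim _) (· = true)
        (isClosed_le continuous_const (continuous_bound _))

/-- Points with admissible choices form a closed set: claims take discrete values, and the
inequalities are continuous in bounds and weights. The choices range over a compact space, so the
projection to points is closed and contains the closure of `G`. -/
theorem SelfSustaining.closure [Fintype S] [∀ s, Fintype (A s)] {M : MDP S A AP} {δ : ℝ}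
    {G : Set (Point S AP)} (h : SelfSustaining M δ G) : SelfSustaining M δ (closure G) := by
  let Z := Point S AP × ((∀ s, A s → unitInterval) × (S → Point S AP))
  -- Distributions are recorded for all states at once, so that the space of choices does not depend
  -- on the point; quantifying over `t` lets the current state select one while each condition stays
  -- closed.
  let R : Set Z := {z | Correct M δ z.1 ∧ (∀ s, ∑ a, (z.2.1 s a : ℝ) = 1) ∧
    (∀ s, z.2.2 s ∈ _root_.closure G ∧ (z.2.2 s).1 = s) ∧
    ∀ t, z.1.1 = t → Consistent z.1
      (fun s => ∑ a, (z.2.1 t a : ℝ) * (M.P t a s).toReal) fun s => z.2.2 s}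
  have hR : IsClosed R := by
    refine ((isClosed_correct M δ).preimage continuous_fst).and (IsClosed.and ?_ (IsClosed.and ?_ ?_))
    · exact isClosed_forall fun s => isClosed_eq (by fun_prop) continuous_const
    · exact isClosed_forall fun s => (isClosed_closure.preimage (by fun_prop)).and
        (isClosed_of_discrete (f := fun z : Z => (z.2.2 s).1) (by fun_prop) (· = s))
    · refine isClosed_forall fun t => isClosed_imp_of_discrete (f := fun z : Z => z.1.1)
        (by fun_prop) (· = t) (isClosed_consistent (by fun_prop) (fun s => ?_) fun s => ?_)
      · fun_prop
      · fun_prop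
  have hsub : _root_.closure G ⊆ Prod.fst '' R := by
    refine closure_minimal (fun x hx => ?_) (isClosedMap_fst_of_compactSpace _ hR)
    obtain ⟨hc, α, y, hy, hcons⟩ := h x hx
    refine ⟨(x, (fun s a => ⟨(α s a).toReal, ENNReal.toReal_nonneg,
      ENNReal.toReal_le_of_le_ofReal zero_le_one (by simpa using (α s).coe_le_one a)⟩, y)),
      ⟨hc, fun s => PMF.sum_toReal _, fun s => ⟨subset_closure (hy s).1, (hy s).2⟩, ?_⟩, rfl⟩
    rintro t rfl
    convert hcons using 2 with s
    exact (PMF.toReal_bind_apply _ _ _).symm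
  intro x hx
  obtain ⟨⟨x, α, y⟩, ⟨hc, hα, hy, hcons⟩, rfl⟩ := hsub hx
  refine ⟨hc, fun s => PMF.ofUnitInterval (α s) (hα s), y, hy, ?_⟩
  convert hcons x.1 rfl using 2 with s
  simp only [next, PMF.toReal_bind_apply, PMF.toReal_ofUnitInterval]

theorem isCompact_sustainable [Fintype S] [∀ s, Fintype (A s)] (M : MDP S A AP) (δ : ℝ) :
    IsCompact (sustainable M δ) := by
  refine IsClosed.isCompact (closure_subset_iff_isClosed.1 ?_)
  exact (selfSustaining_sustainable M δ).closure.subset_sustainable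

/-- A finite net of a compact set of points that is exact where the bounds are close to `1`. -/
theorem exists_finite_net {K : Set (Point S AP)} (hK : IsCompact K)
    (P : Finset (CPCTL AP × CPCTL AP)) {ε : ℝ} (hε : 0 < ε) :
    ∃ F : Set (Point S AP), F.Finite ∧ F ⊆ K ∧ ∃ c : ℝ, 0 < c ∧ c ≤ 1 ∧
      ∀ x ∈ K, ∃ y ∈ F, y.1 = x.1 ∧ ∀ Φ ∈ P, (x.2.2 Φ : ℝ) - ε ≤ y.2.2 Φ ∧
        (1 - c ≤ x.2.2 Φ → (y.2.2 Φ : ℝ) = 1) := by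
  -- Bounds of points near `y` stay below the midpoint of `1` and the bound of `y`, unless the
  -- latter is `1`. Over a finite subcover these gaps have a positive minimum, which yields `c`.
  -- Claims need not agree with those of `y`.
  let U : Point S AP → Set (Point S AP) := fun y => {x | x.1 = y.1 ∧
    ∀ Φ ∈ P, (x.2.2 Φ : ℝ) < y.2.2 Φ + ε ∧ ((y.2.2 Φ : ℝ) = 1 ∨ (x.2.2 Φ : ℝ) < (y.2.2 Φ + 1) / 2)}
  have hU : ∀ y, IsOpen (U y) := by
    intro y
    refine IsOpen.and ((isOpen_discrete {y.1}).preimage continuous_fst) ?_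
    simp only [Set.ofPred_forall]
    refine isOpen_biInter_finset fun Φ _ => IsOpen.and ?_ ?_
    · exact isOpen_lt (continuous_bound Φ) continuous_const
    · by_cases h : (y.2.2 Φ : ℝ) = 1
      · simp only [h, true_or]
        exact isOpen_univ
      · simp only [h, false_or]
        exact isOpen_lt (continuous_bound Φ) continuous_const
  have hmem : ∀ y, y ∈ U y := fun y => ⟨rfl, fun Φ _ => ⟨by linarith, by
    rcases (y.2.2 Φ).2.2.eq_or_lt with h | h
    · exact Or.inl h
    · exact Or.inr (by linarith)⟩⟩
  obtain ⟨F, hFK, hF, hcov⟩ := hK.elim_finite_subcover_image (b := K) (c := U) (fun y _ => hU y)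
    fun x hx => Set.mem_biUnion hx (hmem x)
  have hc : ∀ᶠ c : ℝ in nhdsWithin (0 : ℝ) (Set.Ioi 0), ∀ y ∈ F, ∀ Φ ∈ P,
      (y.2.2 Φ : ℝ) = 1 ∨ c ≤ (1 - y.2.2 Φ) / 2 := by
    refine (Filter.eventually_all_finite hF).2 fun y _ =>
      (Filter.eventually_all_finset P).2 fun Φ _ => ?_
    rcases (y.2.2 Φ).2.2.eq_or_lt with h | h
    · exact Filter.Eventually.of_forall fun _ => Or.inl h
    · have h' : (0 : ℝ) < (1 - y.2.2 Φ) / 2 := by linarith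
      filter_upwards [mem_nhdsWithin_of_mem_nhds (Iio_mem_nhds h')] with c hc
      exact Or.inr (le_of_lt hc)
  obtain ⟨c, hc, hc0, hc1⟩ := (hc.and (Ioo_mem_nhdsGT (zero_lt_one' ℝ))).exists
  refine ⟨F, hF, hFK, c, hc0, hc1.le, fun x hx => ?_⟩
  obtain ⟨y, hy, hxy, hb⟩ := Set.mem_iUnion₂.1 (hcov hx)
  refine ⟨y, hy, hxy.symm, fun Φ hΦ => ⟨by linarith [(hb Φ hΦ).1], fun h => ?_⟩⟩
  refine (hc y hy Φ hΦ).elim id fun h' => (hb Φ hΦ).2.resolve_right fun h'' => ?_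
  linarith

end Topology

end Point

/-! ### The loss caused by periodic jumps. -/

namespace BranchingSystem

variable {S X Y : Type*} [Fintype S]

/-- The value of a system is at most that of a system that maps to it. -/
theorem value_le_value (𝒮 : BranchingSystem S X) (𝒯 : BranchingSystem S Y) (r : Y → X)
    (hw : ∀ y s, 𝒯.weight y s = 𝒮.weight (r y) s)
    (hs : ∀ y s, r (𝒯.succ y s) = 𝒮.succ (r y) s) {A B : X → Prop} {A' B' : Y → Prop}
    (hA : ∀ y, A (r y) → A' y) (hB : ∀ y, B (r y) → B' y) (y : Y) :
    𝒮.value A B (r y) ≤ 𝒯.value A' B' y := by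
  refine 𝒯.le_value (f := fun y => 𝒮.value A B (r y)) (fun y => 𝒮.value_le_one (r y))
    (fun y => ?_) y
  have h := 𝒯.expand_le_one (A := A') (B := B') (f := fun y => 𝒮.value A B (r y))
    (fun y => 𝒮.value_le_one (r y)) y
  have h0 := 𝒯.expand_nonneg (A := A') (B := B') (f := fun y => 𝒮.value A B (r y))
    (fun y => 𝒮.value_nonneg (r y)) y
  simp only
  rw [← congrFun 𝒮.expand_value (r y)]
  by_cases h1 : A (r y)
  · by_cases h2 : B (r y)
    · simp [expand, h1, h2, hA y h1, hB y h2]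
    · by_cases h3 : B' y
      · refine (𝒮.expand_le_one 𝒮.value_le_one (r y)).trans ?_
        simp [expand, hA y h1, h3]
      · simp only [expand, h1, h2, hA y h1, h3, if_true, if_false, hw, hs]
        exact le_of_eq rfl
  · refine le_trans (le_of_eq ?_) h0
    simp [expand, h1]

variable (𝒮 : BranchingSystem S X) (jump : X → X) (N : ℕ)

/-- The system that follows `𝒮` but applies `jump` after every `N` steps. -/
def blocks : BranchingSystem S (ℕ × X) where
  weight z := 𝒮.weight z.2
  succ z s := if z.1 + 1 < N then (z.1 + 1, 𝒮.succ z.2 s) else (0, jump (𝒮.succ z.2 s))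
  weight_nonneg z := 𝒮.weight_nonneg z.2
  sum_weight z := 𝒮.sum_weight z.2

variable {𝒮 jump N} {A B : X → Prop}

/-- An average of numbers at most `1` equals `1` only if all successors of positive weight have
value `1`, and jumps preserve value `1`. So the indicator of value `1` is a post-fixed point of the
system with jumps. -/
theorem value_blocks_eq_one {c : ℝ} (hc : 0 ≤ c)
    (hj : ∀ x, 1 - c ≤ 𝒮.value A B x → 𝒮.value A B (jump x) = 1) (i : ℕ) (x : X)
    (hx : 𝒮.value A B x = 1) :
    (𝒮.blocks jump N).value (fun z => A z.2) (fun z => B z.2) (i, x) = 1 := by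
  classical
  let f : ℕ × X → ℝ := fun z => if 𝒮.value A B z.2 = 1 then 1 else 0
  have hf1 : f ≤ 1 := fun z => by simp only [f]; split_ifs <;> simp
  have hf0 : 0 ≤ f := fun z => by simp only [f]; split_ifs <;> simp
  refine le_antisymm ((𝒮.blocks jump N).value_le_one (i, x)) ?_
  have key := (𝒮.blocks jump N).le_value (A := fun z => A z.2) (B := fun z => B z.2) hf1 ?_ (i, x)
  · simpa [f, hx] using key
  rintro ⟨i, x⟩
  by_cases h : 𝒮.value A B x = 1
  · have h' := h
    rw [← 𝒮.expand_value] at h'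
    unfold expand at h' ⊢
    simp only
    split_ifs at h' ⊢ with h1 h2
    · exact hf1 _
    · have hsucc : ∀ s, 𝒮.weight x s * 𝒮.value A B (𝒮.succ x s) = 𝒮.weight x s := by
        have hle : ∀ s ∈ Finset.univ,
            𝒮.weight x s * 𝒮.value A B (𝒮.succ x s) ≤ 𝒮.weight x s := fun s _ =>
          mul_le_of_le_one_right (𝒮.weight_nonneg x s) (𝒮.value_le_one _)
        exact fun s => (Finset.sum_eq_sum_iff_of_le hle).1 (h'.trans (𝒮.sum_weight x).symm) s
          (Finset.mem_univ s)
      refine (hf1 _).trans (le_of_eq ?_)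
      change 1 = ∑ s, 𝒮.weight x s * f ((𝒮.blocks jump N).succ (i, x) s)
      rw [← 𝒮.sum_weight x]
      refine Finset.sum_congr rfl fun s _ => ?_
      rcases (𝒮.weight_nonneg x s).eq_or_lt with h0 | h0
      · simp [← h0]
      · have hv : 𝒮.value A B (𝒮.succ x s) = 1 :=
          mul_left_cancel₀ h0.ne' ((hsucc s).trans (mul_one _).symm)
        have hv' := hj _ (by rw [hv]; linarith)
        simp only [blocks, f]
        split_ifs <;> simp_all
    · exact absurd h' zero_ne_one
  · have h0 : f (i, x) = 0 := by simp [f, h]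
    rw [h0]
    exact (𝒮.blocks jump N).expand_nonneg hf0 (i, x)

/-- Until the end of the block both systems move alike, so a lower bound after the jump can be
pulled back through the remaining steps. -/
theorem iterate_le_value_blocks {f : X → ℝ}
    (hf : ∀ x, f x ≤ (𝒮.blocks jump N).value (fun z => A z.2) (fun z => B z.2) (0, jump x))
    (k i : ℕ) (hik : i + (k + 1) = N) (x : X) :
    (𝒮.expand A B)^[k + 1] f x ≤
      (𝒮.blocks jump N).value (fun z => A z.2) (fun z => B z.2) (i, x) := by
  induction k generalizing i x with
  | zero =>
    rw [← (𝒮.blocks jump N).expand_value, Function.iterate_one]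
    unfold expand
    split_ifs
    · exact le_rfl
    · refine Finset.sum_le_sum fun s _ => mul_le_mul_of_nonneg_left ?_ (𝒮.weight_nonneg x s)
      simp only [blocks, show ¬ i + 1 < N by omega, if_false]
      exact hf _
    · exact le_rfl
  | succ k ih =>
    rw [← (𝒮.blocks jump N).expand_value, Function.iterate_succ_apply']
    unfold expand
    split_ifs
    · exact le_rfl
    · refine Finset.sum_le_sum fun s _ => mul_le_mul_of_nonneg_left ?_ (𝒮.weight_nonneg x s)
      have h := ih (i + 1) (by omega) (𝒮.succ x s)
      simp only [blocks, show i + 1 < N by omega, if_true]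
      exact h
    · exact le_rfl

/-- Jumps lose little if they are exact where the value is almost `1`, and if the targets of jumps
have almost settled after one block. -/
theorem value_sub_le_value_blocks {c ε : ℝ} (hc : 0 < c) (hε : 0 ≤ ε)
    (hj : ∀ x, 𝒮.value A B x - ε ≤ 𝒮.value A B (jump x))
    (hj1 : ∀ x, 1 - c ≤ 𝒮.value A B x → 𝒮.value A B (jump x) = 1)
    (hN : ∀ x, 𝒮.approx A B N (jump x) ≤ 𝒮.value A B (jump x) + c * ε)
    (i : ℕ) (hi : i < N) (x : X) :
    𝒮.value A B x - 2 * ε ≤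
      (𝒮.blocks jump N).value (fun z => A z.2) (fun z => B z.2) (i, x) := by
  classical
  obtain ⟨n, rfl⟩ : ∃ n, N = n + 1 := ⟨N - 1, by omega⟩
  have hroot : ∀ x, 𝒮.value A B (jump x) - ε ≤
      (𝒮.blocks jump (n + 1)).value (fun z => A z.2) (fun z => B z.2) (0, jump x) := by
    intro x
    -- At the end of a block only the states that jump to value `1` are counted; all others are
    -- given up.
    let f : X → ℝ := fun x => if 1 - c ≤ 𝒮.value A B x then 1 else 0
    have h1 := iterate_le_value_blocks (𝒮 := 𝒮) (jump := jump) (A := A) (B := B) (f := f)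
      (fun x => ?_) n 0 (zero_add (n + 1)) (jump x)
    · refine le_trans ?_ h1
      -- Markov's inequality: the affine function of the value that is `0` at `1 - c` and `1` at `1`
      -- lies below the indicator. Iterated over the block it becomes `approx - (approx - value) /
      -- c`, and `hN` bounds the quotient by `ε`.
      have h2 : (fun x => (1 - 1 / c) * (1 : X → ℝ) x + 1 / c * 𝒮.value A B x) ≤ f := by
        intro x
        have hv : c * ((1 - 1 / c) * (1 : X → ℝ) x + 1 / c * 𝒮.value A B x) =
            c - 1 + 𝒮.value A B x := by
          simp only [Pi.one_apply]
          field_simp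
        have hv1 := 𝒮.value_le_one (A := A) (B := B) x
        simp only [Pi.one_apply] at hv1
        refine le_of_mul_le_mul_left ?_ hc
        rw [hv]
        simp only [f]
        split_ifs <;> linarith
      have h3 := 𝒮.iterate_mono (A := A) (B := B) h2 (n + 1) (jump x)
      rw [iterate_affine, iterate_value] at h3
      refine le_trans ?_ h3
      have h4 := hN x
      have h5 := 𝒮.value_le_approx (A := A) (B := B) (n + 1) (jump x)
      change _ ≤ (1 - 1 / c) * 𝒮.approx A B (n + 1) (jump x) + _
      have h6 : 1 / c * 𝒮.approx A B (n + 1) (jump x) ≤ 1 / c * 𝒮.value A B (jump x) + ε := by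
        have := mul_le_mul_of_nonneg_left h4 (one_div_pos.2 hc).le
        rwa [mul_add, ← mul_assoc, one_div_mul_cancel hc.ne', one_mul] at this
      linarith
    · simp only [f]
      split_ifs with h
      · exact (value_blocks_eq_one hc.le hj1 0 _ (hj1 x h)).ge
      · exact (𝒮.blocks jump (n + 1)).value_nonneg _
  -- One `ε` is lost by the first jump, the other by everything after it.
  have h := iterate_le_value_blocks (𝒮 := 𝒮) (jump := jump) (A := A) (B := B) (f := fun x => 𝒮.value A B x - 2 * ε)
    (fun x => by linarith [hj x, hroot x]) (n - i) i (by omega) x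
  exact (𝒮.sub_le_iterate_sub (by linarith) _ x).trans h

end BranchingSystem

/-! ### Finite memory. -/

/-- A policy run by a memory that stays in a finite set has finite memory. -/
theorem Policy.finiteMemory_of_finite {S : Type u} {A : S → Type v} {Y : Type*} {Z : Set Y}
    (hZ : Z.Finite) (start : S → Y) (upd : Y → S → Y) (act : Y → ∀ s, PMF (A s))
    (run : History S → Y) (h0 : ∀ s, run (.start s) = start s)
    (h1 : ∀ ρ s, run (.snoc ρ s) = upd (run ρ) s) (hs : ∀ s, start s ∈ Z)
    (hu : ∀ z ∈ Z, ∀ s, upd z s ∈ Z) :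
    Policy.FiniteMemory (fun ρ => act (run ρ) ρ.last : Policy A) := by
  classical
  have : Finite Z := hZ
  -- The extra element `none` is the memory before the first state is read; its action is never
  -- used.
  obtain ⟨k, ⟨e⟩⟩ := Finite.exists_equiv_fin (Option Z)
  let upd' : Option Z → S → Option Z := fun m s =>
    some (m.elim ⟨start s, hs s⟩ fun z => ⟨upd z s, hu z z.2 s⟩)
  have hmem : ∀ ρ : History S, ∃ h : run ρ ∈ Z,
      ρ.memory (e none) (fun m s => e (upd' (e.symm m) s)) = e (some ⟨run ρ, h⟩) := by
    intro ρ
    induction ρ with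
    | start s => exact ⟨h0 s ▸ hs s, by simp [History.memory, upd', h0]⟩
    | snoc ρ s ih =>
      obtain ⟨h, ih⟩ := ih
      exact ⟨h1 ρ s ▸ hu _ h s, by simp [History.memory, upd', ih, h1]⟩
  refine ⟨k, e none, fun m s => e (upd' (e.symm m) s),
    fun m s => (e.symm m).elim (act (start s) s) fun z => act z s, fun ρ => ?_⟩
  obtain ⟨h, hρ⟩ := hmem ρ
  simp [hρ]

/-! ### The system on sustainable points. -/

namespace Point

variable {S : Type u} {A : S → Type v} {AP : Type w}

/-- `x` claims that `Φ` is satisfied. -/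
def Claims (Φ : CPCTL AP) (x : Point S AP) : Prop := x.2.1 Φ = true

theorem next_eq_of_fst_eq (M : MDP S A AP) (x : Point S AP) (α : ∀ s, PMF (A s)) {t : S}
    (h : x.1 = t) (s : S) : next M x α s = ((α t).bind (M.P t) s).toReal := by
  subst h
  rfl

variable [Fintype S]

theorem exists_system (M : MDP S A AP) (δ : ℝ) :
    ∃ (α : sustainable M δ → ∀ s, PMF (A s)) (𝒮 : BranchingSystem S (sustainable M δ)),
      (∀ x s, 𝒮.weight x s = next M x.1 (α x) s) ∧ (∀ x s, (𝒮.succ x s).1.1 = s) ∧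
      ∀ x, Consistent x.1 (𝒮.weight x) fun s => (𝒮.succ x s).1 := by
  choose hc α y hy hcons using selfSustaining_sustainable M δ
  exact ⟨fun x => α x.1 x.2, {
    weight := fun x s => next M x.1 (α x.1 x.2) s
    succ := fun x s => ⟨y x.1 x.2 s, (hy x.1 x.2 s).1⟩
    weight_nonneg := fun _ _ => ENNReal.toReal_nonneg
    sum_weight := fun _ => PMF.sum_toReal _ }, fun _ _ => rfl, fun x s => (hy x.1 x.2 s).2,
    fun x => hcons x.1 x.2⟩

variable {M : MDP S A AP} {δ : ℝ} {𝒮 : BranchingSystem S (sustainable M δ)}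

/-- Consistency says exactly that the claimed bounds form a post-fixed point wherever the outcome is
undecided or violated. -/
theorem bound_le_value (h : ∀ x, Consistent x.1 (𝒮.weight x) fun s => (𝒮.succ x s).1)
    (Φ : CPCTL AP × CPCTL AP) (x : sustainable M δ) :
    (x.1.2.2 Φ : ℝ) ≤ 𝒮.value (fun x => Claims Φ.1 x.1) (fun x => Claims Φ.2 x.1) x := by
  refine 𝒮.le_value (f := fun x => (x.1.2.2 Φ : ℝ)) (fun x => (x.1.2.2 Φ).2.2) (fun x => ?_) x
  unfold BranchingSystem.expand
  split_ifs with h1 h2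
  · exact (x.1.2.2 Φ).2.2
  · exact (h x Φ).2 h1 (Bool.eq_false_iff.2 h2)
  · exact ((h x Φ).1 (Bool.eq_false_iff.2 h1)).le

/-- The claimed bounds can be raised to the true values. -/
theorem exists_bound_eq_value {α : sustainable M δ → ∀ s, PMF (A s)}
    (hw : ∀ x s, 𝒮.weight x s = next M x.1 (α x) s) (hs : ∀ x s, (𝒮.succ x s).1.1 = s)
    (h : ∀ x, Consistent x.1 (𝒮.weight x) fun s => (𝒮.succ x s).1) (x : sustainable M δ) :
    ∃ y : sustainable M δ, y.1.1 = x.1.1 ∧ ∀ Φ : CPCTL AP × CPCTL AP, (y.1.2.2 Φ : ℝ) =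
      𝒮.value (fun x => Claims Φ.1 x.1) (fun x => Claims Φ.2 x.1) x := by
  let r : sustainable M δ → Point S AP := fun x => (x.1.1, x.1.2.1, fun Φ =>
    ⟨𝒮.value (fun x => Claims Φ.1 x.1) (fun x => Claims Φ.2 x.1) x, 𝒮.value_nonneg x,
      𝒮.value_le_one x⟩)
  have hr : SelfSustaining M δ (Set.range r) := by
    rintro _ ⟨x, rfl⟩
    obtain ⟨ha, hn, hand, hp⟩ := (selfSustaining_sustainable M δ x.1 x.2).1
    refine ⟨⟨ha, hn, hand, fun q Φ₁ Φ₂ hq => (hp q Φ₁ Φ₂ hq).trans (bound_le_value h _ x)⟩,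
      α x, fun s => r (𝒮.succ x s), fun s => ⟨⟨_, rfl⟩, hs x s⟩, fun Φ => ⟨fun h1 => ?_,
      fun h1 h2 => ?_⟩⟩
    · change 𝒮.value (fun x => Claims Φ.1 x.1) (fun x => Claims Φ.2 x.1) x = 0
      have h1' : ¬ Claims Φ.1 x.1 := Bool.eq_false_iff.1 h1
      rw [← 𝒮.expand_value, BranchingSystem.expand, if_neg h1']
    · change 𝒮.value (fun x => Claims Φ.1 x.1) (fun x => Claims Φ.2 x.1) x ≤
        ∑ s, next M x.1 (α x) s *
          𝒮.value (fun x => Claims Φ.1 x.1) (fun x => Claims Φ.2 x.1) (𝒮.succ x s)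
      have h1' : Claims Φ.1 x.1 := h1
      have h2' : ¬ Claims Φ.2 x.1 := Bool.eq_false_iff.1 h2
      refine le_of_eq ((congrFun 𝒮.expand_value x).symm.trans ?_)
      rw [BranchingSystem.expand, if_pos h1', if_neg h2']
      simp only [hw]
  exact ⟨⟨r x, hr.subset_sustainable ⟨x, rfl⟩⟩, rfl, fun Φ => rfl⟩

open Classical in
/-- The point of a history: what it satisfies with slack `δ`, and the true probabilities. -/
noncomputable def ofHistory (M : MDP S A AP) (δ : ℝ) (π : Policy A) (ρ : History S) : Point S AP :=
  (ρ.last, fun Φ => decide (CPCTL.SatRaised (M.induced π) δ Φ ρ), fun Φ =>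
    ⟨(M.historySystem π).value (CPCTL.SatRaised (M.induced π) δ Φ.1)
      (CPCTL.SatRaised (M.induced π) δ Φ.2) ρ, (M.historySystem π).value_nonneg ρ,
      (M.historySystem π).value_le_one ρ⟩)

/-- The points of all histories sustain each other under `π`: true values satisfy the expansion law
with equality. Only the distribution at the last state matters, so it is arbitrary elsewhere. -/
theorem ofHistory_mem [∀ s, Nonempty (A s)] (M : MDP S A AP) (δ : ℝ) (π : Policy A)
    (ρ : History S) : ofHistory M δ π ρ ∈ sustainable M δ := by
  classical
  refine SelfSustaining.subset_sustainable (G := Set.range (ofHistory M δ π)) ?_ ⟨ρ, rfl⟩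
  rintro _ ⟨ρ, rfl⟩
  refine ⟨⟨fun a h => of_decide_eq_true h, fun a h => ?_, fun Φ₁ Φ₂ h => ?_,
    fun q Φ₁ Φ₂ h => ?_⟩, Function.update (fun s => PMF.pure (Classical.arbitrary (A s)))
      ρ.last (π ρ), fun s => ofHistory M δ π (ρ.snoc s), fun s => ⟨⟨_, rfl⟩, rfl⟩,
      fun Φ => ⟨fun h => ?_, fun h1 h2 => ?_⟩⟩
  · have h' : CPCTL.SatRaised (M.induced π) δ (.negAtom a) ρ := of_decide_eq_true h
    exact h'
  · have h' : CPCTL.SatRaised (M.induced π) δ (.and Φ₁ Φ₂) ρ := of_decide_eq_true h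
    exact ⟨decide_eq_true h'.1, decide_eq_true h'.2⟩
  · have h' : CPCTL.SatRaised (M.induced π) δ (.probW q Φ₁ Φ₂) ρ := of_decide_eq_true h
    exact h'.trans_eq (M.pathMeasure_induced_weakUntil π _ _ ρ)
  · change (M.historySystem π).value _ _ ρ = 0
    rw [← (M.historySystem π).expand_value, BranchingSystem.expand, if_neg (of_decide_eq_false h)]
  · refine le_of_eq ((congrFun (M.historySystem π).expand_value ρ).symm.trans ?_)
    rw [BranchingSystem.expand, if_pos (of_decide_eq_true h1), if_neg (of_decide_eq_false h2)]
    refine Finset.sum_congr rfl fun s _ => ?_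
    rw [next_eq_of_fst_eq M _ _ (t := ρ.last) rfl, Function.update_self]
    rfl

end Point

/-! ### Construction of the finite-memory policy. -/

namespace CPCTL

variable {AP : Type w}

open Classical in
/-- The pairs `(Φ₁, Φ₂)` for which `Φ₁ W (Φ₁ ∧ Φ₂)` occurs in a formula. -/
noncomputable def untilPairs : CPCTL AP → Finset (CPCTL AP × CPCTL AP)
  | atom _ => ∅
  | negAtom _ => ∅
  | and Φ₁ Φ₂ => untilPairs Φ₁ ∪ untilPairs Φ₂
  | probW _ Φ₁ Φ₂ => insert (Φ₁, Φ₂) (untilPairs Φ₁ ∪ untilPairs Φ₂)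

end CPCTL

namespace MDP

variable {S : Type u} {A : S → Type v} {AP : Type w}

/-- A chain whose histories carry correct points satisfies the claims of these points, provided
that the probabilities fall short of the claims by at most the slack. -/
theorem sat_of_claims [Fintype S] (M : MDP S A AP) {δ : ℝ} {π' : Policy A}
    (x : History S → Point S AP) (hx : ∀ ρ, (x ρ).1 = ρ.last) (hc : ∀ ρ, (x ρ).Correct M δ)
    {P : Finset (CPCTL AP × CPCTL AP)}
    (hP : ∀ Φ ∈ P, ∀ C D : History S → Prop, (∀ ρ, (x ρ).Claims Φ.1 → C ρ) →
      (∀ ρ, (x ρ).Claims Φ.2 → D ρ) →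
      ∀ ρ, ((x ρ).2.2 Φ : ℝ) - δ ≤ (M.historySystem π').value C D ρ)
    (Φ : CPCTL AP) (hΦ : Φ.untilPairs ⊆ P) (ρ : History S) (h : (x ρ).Claims Φ) :
    CPCTL.Sat (M.induced π') Φ ρ := by
  classical
  induction Φ generalizing ρ with
  | atom a =>
    have h' := (hc ρ).1 a h
    rwa [hx ρ] at h'
  | negAtom a =>
    have h' := (hc ρ).2.1 a h
    rwa [hx ρ] at h'
  | and Φ₁ Φ₂ ih₁ ih₂ =>
    have h' := (hc ρ).2.2.1 Φ₁ Φ₂ h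
    rw [CPCTL.untilPairs] at hΦ
    exact ⟨ih₁ (Finset.union_subset_left hΦ) ρ h'.1, ih₂ (Finset.union_subset_right hΦ) ρ h'.2⟩
  | probW q Φ₁ Φ₂ ih₁ ih₂ =>
    rw [CPCTL.untilPairs, Finset.insert_subset_iff] at hΦ
    have h' := (hc ρ).2.2.2 q Φ₁ Φ₂ h
    have hv := hP _ hΦ.1 _ _ (ih₁ (Finset.union_subset_left hΦ.2))
      (ih₂ (Finset.union_subset_right hΦ.2)) ρ
    rw [← M.pathMeasure_induced_weakUntil π'] at hv
    exact le_trans (by linarith) hv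

theorem exists_finiteMemory_sat [Fintype S] [∀ s, Fintype (A s)] [∀ s, Nonempty (A s)]
    (M : MDP S A AP) (Φ : CPCTL AP) (π : Policy A) {δ : ℝ} (hδ : 0 < δ)
    (hπ : CPCTL.SatRaised (M.induced π) δ Φ (.start M.init)) :
    ∃ π' : Policy A, π'.FiniteMemory ∧ CPCTL.Sat (M.induced π') Φ (.start M.init) := by
  classical
  let _ : TopologicalSpace S := ⊥
  have : DiscreteTopology S := ⟨rfl⟩
  obtain ⟨α, 𝒮, hw, hs, hcons⟩ := Point.exists_system M δ
  let K := Point.sustainable M δ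
  let P := Φ.untilPairs
  let V : CPCTL AP × CPCTL AP → K → ℝ := fun Ψ =>
    𝒮.value (fun x => Point.Claims Ψ.1 x.1) (fun x => Point.Claims Ψ.2 x.1)
  have hbound : ∀ Ψ (x : K), (x.1.2.2 Ψ : ℝ) ≤ V Ψ x := Point.bound_le_value hcons
  obtain ⟨F, hF, hFK, c, hc0, -, hnet⟩ := Point.exists_finite_net
    (Point.isCompact_sustainable M δ) P (half_pos hδ)
  have hjump : ∀ x : K, ∃ y : K, y.1 ∈ F ∧ y.1.1 = x.1.1 ∧ ∀ Ψ ∈ P,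
      V Ψ x - δ / 2 ≤ V Ψ y ∧ (1 - c ≤ V Ψ x → V Ψ y = 1) := by
    intro x
    -- The net compares claimed bounds, but the jump estimates concern values; raising the bounds of
    -- `x` to its values first closes this gap.
    obtain ⟨x', hx', hv⟩ := Point.exists_bound_eq_value hw hs hcons x
    obtain ⟨y, hyF, hy, hb⟩ := hnet x'.1 x'.2
    refine ⟨⟨y, hFK hyF⟩, hyF, hy.trans hx', fun Ψ hΨ => ?_⟩
    have h := hb Ψ hΨ
    rw [hv Ψ] at h
    exact ⟨h.1.trans (hbound Ψ ⟨y, hFK hyF⟩), fun h1 => le_antisymm (𝒮.value_le_one _)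
      ((h.2 h1).symm.trans_le (hbound Ψ ⟨y, hFK hyF⟩))⟩
  choose jump hjF hjs hj using hjump
  have hFfin : {y : K | y.1 ∈ F}.Finite := hF.preimage Subtype.val_injective.injOn
  obtain ⟨N, hN, hN0⟩ : ∃ N, (∀ y ∈ {y : K | y.1 ∈ F}, ∀ Ψ ∈ P,
      𝒮.approx (fun x => Point.Claims Ψ.1 x.1) (fun x => Point.Claims Ψ.2 x.1) N y ≤
        V Ψ y + c * (δ / 2)) ∧ 0 < N := by
    have h : ∀ᶠ N in Filter.atTop, ∀ y ∈ {y : K | y.1 ∈ F}, ∀ Ψ ∈ P,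
        𝒮.approx (fun x => Point.Claims Ψ.1 x.1) (fun x => Point.Claims Ψ.2 x.1) N y ≤
          V Ψ y + c * (δ / 2) := by
      refine (Filter.eventually_all_finite hFfin).2 fun y _ =>
        (Filter.eventually_all_finset P).2 fun Ψ _ => ?_
      exact (𝒮.tendsto_approx y).eventually_le_const
        (lt_add_of_pos_right _ (mul_pos hc0 (half_pos hδ)))
    exact (h.and (Filter.eventually_gt_atTop 0)).exists
  let 𝒯 := 𝒮.blocks jump N
  -- The first block starts at exact points of `π`, one for each possible first state, so the claim
  -- of `Φ` at the initial state is not disturbed by a jump.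
  let start : S → ℕ × K := fun s => (0, ⟨Point.ofHistory M δ π (.start s),
    Point.ofHistory_mem M δ π _⟩)
  let run : History S → ℕ × K := fun ρ => ρ.rec start fun _ s z => 𝒯.succ z s
  have hrun_lt : ∀ ρ, (run ρ).1 < N := by
    intro ρ
    cases ρ with
    | start s => exact hN0
    | snoc ρ s =>
      change (𝒯.succ (run ρ) s).1 < N
      simp only [𝒯, BranchingSystem.blocks]
      split_ifs with h
      · exact h
      · exact hN0
  have hrun_state : ∀ ρ, (run ρ).2.1.1 = ρ.last := by
    intro ρ
    cases ρ with
    | start s => rfl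
    | snoc ρ s =>
      change (𝒯.succ (run ρ) s).2.1.1 = s
      simp only [𝒯, BranchingSystem.blocks]
      split_ifs
      · exact hs _ _
      · exact (hjs _).trans (hs _ _)
  let π' : Policy A := fun ρ => α (run ρ).2 ρ.last
  have hfin : π'.FiniteMemory := by
    -- Each block begins in a finite set and branches finitely for fewer than `N` steps, so the
    -- pairs of clock and point that occur are finite in number.
    let reach : ℕ → Set K := fun n => n.rec ({y : K | y.1 ∈ F} ∪ Set.range fun s => (start s).2)
      fun _ R => Set.image2 𝒮.succ R Set.univ
    have hreach : ∀ n, (reach n).Finite := by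
      intro n
      induction n with
      | zero => exact hFfin.union (Set.finite_range _)
      | succ n ih => exact ih.image2 _ Set.finite_univ
    refine Policy.finiteMemory_of_finite (Z := ⋃ n ∈ Set.Iio N, {n} ×ˢ reach n)
      ((Set.finite_Iio N).biUnion fun n _ => (Set.finite_singleton n).prod (hreach n)) start 𝒯.succ
      (fun z => α z.2) run (fun _ => rfl) (fun _ _ => rfl) (fun s => ?_) fun z hz s => ?_
    · exact Set.mem_biUnion (x := 0) hN0 ⟨rfl, Or.inr ⟨s, rfl⟩⟩
    · obtain ⟨n, hn, hzn, hzr⟩ := Set.mem_iUnion₂.1 hz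
      simp only [𝒯, BranchingSystem.blocks]
      split_ifs with h
      · exact Set.mem_biUnion (x := z.1 + 1) h ⟨rfl, _, (hzn : z.1 = n) ▸ hzr, s, trivial, rfl⟩
      · exact Set.mem_biUnion (x := 0) hN0 ⟨rfl, Or.inl (hjF _)⟩
  refine ⟨π', hfin, M.sat_of_claims (fun ρ => (run ρ).2.1) hrun_state
    (fun ρ => (Point.selfSustaining_sustainable M δ _ (run ρ).2.2).1) (P := P) ?_ Φ le_rfl _
    (decide_eq_true hπ)⟩
  intro Ψ hΨ C D hC hD ρ
  have h1 := BranchingSystem.value_sub_le_value_blocks hc0 (half_pos hδ).le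
    (fun x => (hj x Ψ hΨ).1) (fun x => (hj x Ψ hΨ).2) (fun x => hN _ (hjF x) Ψ hΨ)
    (run ρ).1 (hrun_lt ρ) (run ρ).2
  have h2 := 𝒯.value_le_value (M.historySystem π') run (fun ρ s => ?_) (fun ρ s => rfl)
    (A := fun z => Point.Claims Ψ.1 z.2.1) (B := fun z => Point.Claims Ψ.2 z.2.1) hC hD ρ
  · have h3 := hbound Ψ (run ρ).2
    exact le_trans (by linarith) (h1.trans h2)
  · exact ((hw _ s).trans (Point.next_eq_of_fst_eq M _ _ (hrun_state ρ) s)).symm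

end MDP

theorem mainTheorem7 {S : Type u} {A : S → Type v} {AP : Type w} [Finite S]
    [∀ s, Finite (A s)] [∀ s, Nonempty (A s)] [Finite AP]
    (M : MDP S A AP) (Φ : CPCTL AP) (π : Policy A) (hπ : M.StrictlySatisfies π Φ)
    (η : ℝ) (hη : 0 ≤ η) :
    ∃ π' : Policy A, π'.FiniteMemory ∧
      CPCTL.probability (M.induced π') Φ ≥
        CPCTL.probability (M.induced π) (Φ.T (Φ.loweredThresholds η)) := by
  have := Fintype.ofFinite S
  have := fun s => Fintype.ofFinite (A s)
  obtain ⟨q, hq, hsat⟩ := hπ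
  obtain ⟨δ, hδ, hqδ⟩ := Φ.exists_pos_forall_add_le q hq
  obtain ⟨π', hfin, hπ'⟩ := M.exists_finiteMemory_sat Φ π hδ
    (CPCTL.satRaised_of_sat_T _ Φ q hqδ _ hsat)
  refine ⟨π', hfin, ?_⟩
  rw [CPCTL.probability_eq_one (M.induced π') Φ hπ']
  exact CPCTL.probability_le_one _ _
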